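/- Let $(a_k)_{k\ge 2}$ be a probability distribution on $\{2,3,\dots\}$ with generating function $G(s)=\sum_{k\ge2}a_ks^k$. Let $\mathbb Q$ be the law of the infinite random tree with distinguished vertex $0$ in which the degrees $D_i$ of the vertices $i$ are independent with $\mathbb Q(D_i=k)=a_k$ (so $0$ has $D_0$ children and every other vertex $i$ has $D_i-1$ children). Given the tree, let $(T_i)$ be independent rate-one exponential arrival times at the vertices, and start with all sites vacant; the car arriving at $i$ at time $T_i$ parks there if and only if $i$ and all neighbours of $i$ are vacant immediately before time $T_i$, and parked cars stay for ever. Let $n_i(t)\in\{0,1\}$ indicate whether $i$ is occupied at time $t$, and let $\mathbb E$ be the expectation over the arrival times. Then: 1. For $\mathbb Q$-almost every tree and almost all arrival times there is exactly one family $(n_i(t))$ obeying these rules; and for every $t\ge0$, $n_0(t)$ is integrable with respect to the arrival times for $\mathbb Q$-almost every tree, and $\mathbb E(n_0(t))$ is $\mathbb Q$-integrable. 2. For every $u\ge0$ there is exactly one $\alpha(u)\in(0,1]$ with $\int_{\alpha(u)}^1\frac{x\,dx}{G(x)}=u$. 3. For every $t\ge0$, $$\mathbb Q\,\mathbb E(n_0(t))=\frac{1-\alpha(1-e^{-t})^2}{2},$$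 where $\alpha(1-e^{-t})^2$ is the square of the value of $\alpha$ at $1-e^{-t}$. In particular $\lim_{t\to\infty}\mathbb Q\,\mathbb E(n_0(t))=(1-\alpha(1)^2)/2$, where $\int_{\alpha(1)}^1\frac{x\,dx}{G(x)}=1$. 4. In the deterministic case of the regular tree in which every vertex has $d\ge2$ neighbours, for every $t\ge 0$, $$\mathbb E(n_0(t))=\tfrac12\bigl(1-e^{-2(1-e^{-t})}\bigr)\ \text{ if } d=2 \text{ (the integers)},\qquad \mathbb E(n_0(t))=\tfrac12\Bigl(1-\bigl(1+(d-2)(1-e^{-t})\bigr)^{-\frac{2}{d-2}}\Bigr)\ \text{ if } d>2.$$ -/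

import Mathlib

open MeasureTheory ProbabilityTheory Filter Topology Set

noncomputable section

namespace RandomTreeParking

/-! ### Infinite rooted trees with prescribed degrees -/

/-- Labels of potential vertices: the root is `[]`, and the `j`-th child of `v` is `j :: v`. -/
abbrev Label : Type := List ℕ

/-- The number of children of `v` when `v` is to have `D v` neighbours: the root has no parent,
every other vertex has exactly one. -/
def numChildren (D : Label → ℕ) : Label → ℕ
  | [] => D []
  | j :: v => D (j :: v) - 1

/-- The labels which are present in the tree with degrees `D`. -/
def IsVertex (D : Label → ℕ) : Label → Prop
  | [] => True
  | j :: v => IsVertex D v ∧ j < numChildren D v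

/-- The vertex set of the tree with degrees `D`. -/
abbrev Vertex (D : Label → ℕ) : Type := {v : Label // IsVertex D v}

/-- The root of the tree (the site `0`). -/
def root (D : Label → ℕ) : Vertex D := ⟨[], trivial⟩

/-- The tree with degrees `D`: every vertex is joined to its children. -/
def tree (D : Label → ℕ) : SimpleGraph (Vertex D) where
  Adj v w := (∃ j, w.1 = j :: v.1) ∨ (∃ j, v.1 = j :: w.1)
  symm := ⟨fun _ _ h => h.symm⟩
  loopless := ⟨fun v h => by
    rcases h with ⟨j, h⟩ | ⟨j, h⟩ <;> exact absurd (congrArg List.length h) (by simp)⟩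

/-- The law of the random tree: i.i.d. degrees with distribution `a`. -/
def treeLaw (a : PMF ℕ) : Measure (Label → ℕ) := Measure.infinitePi fun _ => a.toMeasure

/-- The generating function `G(s) = ∑ a_k s^k`. -/
def genFun (a : PMF ℕ) (s : ℝ) : ℝ := ∑' k, (a k).toReal * s ^ k

/-! ### Blocking random sequential adsorption on a graph -/

/-- Occupation numbers: `0` is vacant, `1` is occupied. -/
abbrev Config (V : Type*) : Type _ := V → Fin 2

/-- `n t` is the configuration at time `t` when the first car arrives at site `k` at time `T k`:
site `k` is occupied at time `t` if and only if its car has arrived by time `t` and, immediately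
before that arrival, `k` and all its neighbours were vacant. (An occupied site stays occupied, so
being vacant immediately before `T k` is being vacant at all earlier times. A site whose first car
is rejected is blocked for ever, so that later arrivals there have no effect.) For positive `T`
the initial configuration is empty. -/
def IsParkingHistory {V : Type*} (G : SimpleGraph V) (T : V → ℝ) (n : ℝ → Config V) : Prop :=
  ∀ t k, n t k = 1 ↔ T k ≤ t ∧ ∀ i, (i = k ∨ G.Adj k i) → ∀ s < T k, n s i = 0

/-- The parking process driven by the first arrival times `T`. -/
def parking {V : Type*} (G : SimpleGraph V) (T : V → ℝ) : ℝ → Config V :=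
  Classical.epsilon fun n => IsParkingHistory G T n

/-- The law of the first arrival times: independent, exponential with rate one. -/
def arrivalLaw (V : Type*) : Measure (V → ℝ) := Measure.infinitePi fun _ => expMeasure 1

/-- The occupation number `n_v(t)`, as a real random variable on the space of arrival times. -/
def occupation {V : Type*} (G : SimpleGraph V) (v : V) (t : ℝ) (T : V → ℝ) : ℝ :=
  ((parking G T t v : ℕ) : ℝ)

/-- The expectation `𝔼 n_v(t)` over the dynamics on a fixed graph. -/
def meanOccupation {V : Type*} (G : SimpleGraph V) (v : V) (t : ℝ) : ℝ :=
  ∫ T, occupation G v t T ∂(arrivalLaw V)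

/-- The expectation of `n_0(t)`, averaged over the dynamics and over the law of the tree. -/
def averagedOccupation (a : PMF ℕ) (t : ℝ) : ℝ :=
  ∫ D, meanOccupation (tree D) (root D) t ∂(treeLaw a)

end RandomTreeParking

end

/-! A car parks iff no neighbour with an earlier arrival has parked. Seen from a vertex `v`, a child
that arrives before `v` cannot be hindered by `v`, so its fate depends only on its own branch. This
gives a recursion down the tree, which branches make independent. Cutting it off after `n`
generations (`Wins`) gives bounds of alternating sense: even truncations decrease, odd ones
increase, and every odd one implies every even one.

Write g(x) = ∑ a_k x^(k-1) = G(x)/x, and let U(s), L(s) be the limiting even and odd probabilities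
that the root of a branch arrives before `s` and wins. By independence U' = e^(-s) g(1-L) and L' =
e^(-s) g(1-U), in integrated form. Hence U' g(1-U) = L' g(1-L), and since g > 0 on (0,1] this forces
U = L (`lowerProb_pred_eq`). So almost surely the truncations agree in the limit at every vertex
(`ae_decided`), which yields existence and uniqueness of the process (`existsUnique_isAccepted`).

Separating variables in U' = e^(-s) g(1-U) gives ∫ x/G(x) dx = 1 - e^(-s) over [1-U(s), 1]
(`integral_div_genFun`), that is, α = 1-U. The vertex 0 has one more branch than the other vertices
of the same degree, so its density is e^(-s) G(1-U) = (1-U) U', whose integral is (1-α²)/2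
(`upperProb_id_eq`). -/

noncomputable section

namespace RandomTreeParking

/-! ### Parking histories and sets of accepted cars -/

/-- `P` is the set of sites whose car is accepted: the car at `k` parks if and only if no
neighbour with an earlier arrival has parked. -/
def IsAccepted {V : Type*} (G : SimpleGraph V) (T : V → ℝ) (P : V → Prop) : Prop :=
  ∀ k, P k ↔ ∀ i, G.Adj k i → T i < T k → ¬ P i

/-- A site is occupied exactly from its arrival on, if it is accepted at all. Thus vacancy of `i` at
all times before `T k` fails only when `i` is accepted with `T i < T k`, and time drops out of the
rule. -/
theorem isParkingHistory_iff {V : Type*} {G : SimpleGraph V} {T : V → ℝ} {n : ℝ → Config V} :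
    IsParkingHistory G T n ↔
      ∃ P, IsAccepted G T P ∧ ∀ t k, n t k = 1 ↔ T k ≤ t ∧ P k := by
  have key (x : Fin 2) : x = 0 ↔ ¬ x = 1 := by omega
  have vac {P : V → Prop} (hP : ∀ t k, n t k = 1 ↔ T k ≤ t ∧ P k) (k i : V) :
      (∀ s < T k, n s i = 0) ↔ (T i < T k → ¬ P i) := by
    constructor
    · intro h hi hPi
      exact (key _).1 (h (T i) hi) ((hP _ _).2 ⟨le_rfl, hPi⟩)
    · intro h s hs
      refine (key _).2 fun h1 => ?_
      obtain ⟨h2, h3⟩ := (hP _ _).1 h1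
      exact h (h2.trans_lt hs) h3
  constructor
  · intro h
    refine ⟨fun k => ∀ i, (i = k ∨ G.Adj k i) → ∀ s < T k, n s i = 0, fun k => ?_, h⟩
    constructor
    · intro hk i hi
      exact (vac h k i).1 (hk i (Or.inr hi))
    · rintro hk i (rfl | hi)
      · exact (vac h i i).2 fun h => absurd h (lt_irrefl _)
      · exact (vac h k i).2 (hk i hi)
  · rintro ⟨P, hP, hn⟩ t k
    rw [hn, hP k]
    refine and_congr_right fun _ => ⟨?_, fun h i hi => (vac hn k i).1 (h i (Or.inr hi))⟩
    rintro hk i (rfl | hi)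
    · exact (vac hn i i).2 fun h => absurd h (lt_irrefl _)
    · exact (vac hn k i).2 (hk i hi)

theorem existsUnique_isParkingHistory {V : Type*} {G : SimpleGraph V} {T : V → ℝ}
    (h : ∃! P, IsAccepted G T P) : ∃! n, IsParkingHistory G T n := by
  classical
  obtain ⟨P, hP, hu⟩ := h
  refine ⟨fun t k => if T k ≤ t ∧ P k then 1 else 0,
    isParkingHistory_iff.2 ⟨P, hP, fun t k => by simp⟩, fun n hn => ?_⟩
  obtain ⟨Q, hQ, hn⟩ := isParkingHistory_iff.1 hn
  obtain rfl := hu Q hQ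
  funext t k
  by_cases h : T k ≤ t ∧ Q k
  · simp only [h, and_self, if_true, (hn t k).2 h]
  · have := mt (hn t k).1 h
    simp only [h, if_false]
    omega

theorem parking_eq_one_iff {V : Type*} {G : SimpleGraph V} {T : V → ℝ} {P : V → Prop}
    (hP : IsAccepted G T P) (h : ∃! P, IsAccepted G T P) (t : ℝ) (k : V) :
    parking G T t k = 1 ↔ T k ≤ t ∧ P k := by
  have := Classical.epsilon_spec (existsUnique_isParkingHistory h).exists
  obtain ⟨Q, hQ, hn⟩ := isParkingHistory_iff.1 this
  obtain rfl := h.unique hP hQ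
  exact hn t k

/-! ### Finite truncations of the parking process towards the leaves -/

/-- `Wins c T n v`: the car at `v` parks when only `v` and its descendants down to `n - 1`
generations are taken into account, in the tree with child numbers `c`. -/
def Wins (c : Label → ℕ) (T : Label → ℝ) : ℕ → Label → Prop
  | 0, _ => True
  | n + 1, v => ∀ j < c v, T (j :: v) < T v → ¬ Wins c T n (j :: v)

/-- The car at `v` parks in all the truncations which favour it. -/
def EventuallyWins (c : Label → ℕ) (T : Label → ℝ) (v : Label) : Prop :=
  ∀ n, Wins c T (2 * n) v

/-- The truncations from above and from below agree in the limit. -/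
def Decided (c : Label → ℕ) (T : Label → ℝ) (v : Label) : Prop :=
  EventuallyWins c T v → ∃ n, Wins c T (2 * n + 1) v

variable {c : Label → ℕ} {T : Label → ℝ} {D : Label → ℕ}

/-- Passing to the children negates the claim and exchanges the two parities, so the induction runs
on `n + m`. -/
theorem Wins.even_of_odd {n m : ℕ} {v : Label} (h : Wins c T (2 * n + 1) v) :
    Wins c T (2 * m) v := by
  induction hk : n + m generalizing n m v with
  | zero =>
    obtain rfl : m = 0 := by omega
    trivial
  | succ k ih =>
    cases m with
    | zero => trivial
    | succ m =>
      intro j hj hT hw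
      exact h j hj hT (ih (n := m) (m := n) hw (by omega))

theorem Wins.odd_mono {n : ℕ} {v : Label} : (Wins c T (2 * n + 1) v → Wins c T (2 * (n + 1) + 1) v)
    ∧ (Wins c T (2 * (n + 1)) v → Wins c T (2 * n) v) := by
  induction n generalizing v with
  | zero =>
    refine ⟨fun h j hj hT hw => h j hj hT trivial, fun _ => trivial⟩
  | succ n ih =>
    have h2 {v : Label} (h : Wins c T (2 * (n + 1 + 1)) v) : Wins c T (2 * (n + 1)) v :=
      fun j hj hT hw => h j hj hT (ih.1 hw)
    exact ⟨fun h j hj hT hw => h j hj hT (h2 hw), h2⟩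

theorem eventuallyWins_iff {v : Label} (h : ∀ j < c v, Decided c T (j :: v)) :
    EventuallyWins c T v ↔ ∀ j < c v, T (j :: v) < T v → ¬ EventuallyWins c T (j :: v) := by
  constructor
  · intro hv j hj hT hw
    obtain ⟨n, hn⟩ := h j hj hw
    exact hv (n + 1) j hj hT hn
  · rintro hv (_ | n)
    · trivial
    · intro j hj hT hw
      exact hv j hj hT fun m => Wins.even_of_odd hw

/-- Any solution `S` of the recursion lies between the odd and the even truncations, so it is
determined wherever these agree in the limit. -/
theorem iff_eventuallyWins {S : Label → Prop}
    (hS : ∀ v, IsVertex D v →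
      (S v ↔ ∀ j < numChildren D v, T (j :: v) < T v → ¬ S (j :: v)))
    {v : Label} (hv : IsVertex D v) (hd : Decided (numChildren D) T v) :
    S v ↔ EventuallyWins (numChildren D) T v := by
  have key (n : ℕ) : ∀ v, IsVertex D v → (S v → Wins (numChildren D) T (2 * n) v) ∧
      (Wins (numChildren D) T (2 * n + 1) v → S v) := by
    induction n with
    | zero =>
      exact fun v hv => ⟨fun _ => trivial, fun h => (hS v hv).2 fun j hj hT _ => h j hj hT trivial⟩
    | succ n ih =>
      have h1 {v} (hv : IsVertex D v) (h : S v) : Wins (numChildren D) T (2 * (n + 1)) v :=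
        fun j hj hT hw => (hS v hv).1 h j hj hT ((ih (j :: v) ⟨hv, hj⟩).2 hw)
      exact fun v hv => ⟨h1 hv, fun h => (hS v hv).2 fun j hj hT hs =>
        h j hj hT (h1 ⟨hv, hj⟩ hs)⟩
  refine ⟨fun h n => (key n v hv).1 h, fun h => ?_⟩
  obtain ⟨n, hn⟩ := hd h
  exact (key n v hv).2 hn

theorem Wins.congr {T' : Label → ℝ} (hT : ∀ v, IsVertex D v → T v = T' v) (n : ℕ) :
    ∀ v, IsVertex D v → (Wins (numChildren D) T n v ↔ Wins (numChildren D) T' n v) := by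
  induction n with
  | zero => exact fun _ _ => Iff.rfl
  | succ n ih =>
    intro v hv
    refine forall₂_congr fun j hj => ?_
    rw [hT v hv, hT (j :: v) ⟨hv, hj⟩, ih (j :: v) ⟨hv, hj⟩]

/-! ### The accepted cars on a tree -/

/-- The accepted cars: those which park in the tree of descendants and find the parent vacant. -/
def Accepted (c : Label → ℕ) (T : Label → ℝ) : Label → Prop
  | [] => EventuallyWins c T []
  | j :: v => EventuallyWins c T (j :: v) ∧ (T v < T (j :: v) → ¬ Accepted c T v)

theorem tree_forall_adj {D : Label → ℕ} {k : Vertex D} {p : Label → Prop} :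
    (∀ i, (tree D).Adj k i → p i.1) ↔
      (∀ j < numChildren D k.1, p (j :: k.1)) ∧ ∀ j w, k.1 = j :: w → p w := by
  constructor
  · intro h
    refine ⟨fun j hj => h ⟨j :: k.1, k.2, hj⟩ (Or.inl ⟨j, rfl⟩), fun j w hw => ?_⟩
    have : IsVertex D w := by
      have := k.2
      rw [hw] at this
      exact this.1
    exact h ⟨w, this⟩ (Or.inr ⟨j, hw⟩)
  · rintro ⟨h1, h2⟩ i (⟨j, hj⟩ | ⟨j, hj⟩)
    · have := i.2
      rw [hj] at this ⊢
      exact h1 j this.2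
    · exact h2 j _ hj

theorem isAccepted_tree_iff {T : Label → ℝ} {P : Label → Prop} :
    IsAccepted (tree D) (fun k => T k.1) (fun k => P k.1) ↔
      ∀ v, IsVertex D v → (P v ↔ (∀ j < numChildren D v, T (j :: v) < T v → ¬ P (j :: v)) ∧
        ∀ j w, v = j :: w → T w < T v → ¬ P w) := by
  unfold IsAccepted
  rw [Subtype.forall]
  refine forall₂_congr fun v hv => ?_
  rw [← tree_forall_adj (k := ⟨v, hv⟩) (p := fun i => T i < T v → ¬ P i)]

theorem isAccepted_accepted (h : ∀ v, IsVertex D v → Decided (numChildren D) T v) :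
    IsAccepted (tree D) (fun k => T k.1) fun k => Accepted (numChildren D) T k.1 := by
  refine isAccepted_tree_iff.2 fun v hv => ?_
  have h1 : (∀ j < numChildren D v, T (j :: v) < T v → ¬ Accepted (numChildren D) T (j :: v)) ↔
      EventuallyWins (numChildren D) T v := by
    rw [eventuallyWins_iff fun j hj => h _ ⟨hv, hj⟩]
    refine forall₃_congr fun j _ hT => ?_
    -- For a child that arrives before its parent, the clause about the parent is vacuous.
    simp [Accepted, hT.not_gt]
  rw [h1]
  cases v with
  | nil => simp [Accepted]
  | cons j v => simp [Accepted]

/-- The condition on the children alone satisfies the downward recursion, hence equals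
`EventuallyWins`. The condition on the parent is then settled by induction from the root outwards.
-/
theorem IsAccepted.iff_accepted (h : ∀ v, IsVertex D v → Decided (numChildren D) T v)
    {P : Label → Prop} (hP : IsAccepted (tree D) (fun k => T k.1) fun k => P k.1) :
    ∀ v, IsVertex D v → (P v ↔ Accepted (numChildren D) T v) := by
  rw [isAccepted_tree_iff] at hP
  have hS : ∀ v, IsVertex D v →
      ((∀ j < numChildren D v, T (j :: v) < T v → ¬ P (j :: v)) ↔
        EventuallyWins (numChildren D) T v) := by
    intro v hv
    refine iff_eventuallyWins
      (S := fun v => ∀ j < numChildren D v, T (j :: v) < T v → ¬ P (j :: v))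
      (fun v hv => forall₃_congr fun j hj hT => ?_) hv (h v hv)
    rw [hP (j :: v) ⟨hv, hj⟩]
    have : ∀ j' w, j :: v = j' :: w → T w < T (j :: v) → ¬ P w := by
      rintro j' w e hw
      obtain ⟨-, rfl⟩ := List.cons.inj e
      exact absurd hw hT.not_gt
    exact not_congr (and_iff_left this)
  intro v
  induction v with
  | nil =>
    intro hv
    rw [hP [] hv, hS [] hv]
    simp [Accepted]
  | cons j v ih =>
    intro hv
    rw [hP _ hv, hS _ hv, Accepted, ← ih hv.1]
    simp

theorem existsUnique_isAccepted (h : ∀ v, IsVertex D v → Decided (numChildren D) T v) :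
    ∃! P, IsAccepted (tree D) (fun k => T k.1) P := by
  refine ⟨_, isAccepted_accepted h, fun P hP => ?_⟩
  classical
  let Q : Label → Prop := fun v => if hv : IsVertex D v then P ⟨v, hv⟩ else False
  have hQ : (fun k : Vertex D => Q k.1) = P := by
    funext k
    simp [Q, k.2]
  rw [← hQ] at hP ⊢
  funext k
  exact propext (hP.iff_accepted h k.1 k.2)

/-! ### Product measures indexed by labels -/

/-- Finite-dimensional marginals determine the law, and it suffices to test them on products of
rectangles, where both sides factor. -/
theorem infinitePi_map_zip {ι X Y : Type*} [MeasurableSpace X] [MeasurableSpace Y]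
    (μ : Measure X) (ν : Measure Y) [IsProbabilityMeasure μ] [IsProbabilityMeasure ν] :
    ((Measure.infinitePi fun _ : ι => μ).prod (Measure.infinitePi fun _ : ι => ν)).map
      (fun p i => (p.1 i, p.2 i)) = Measure.infinitePi fun _ => μ.prod ν := by
  refine ((Measure.isProjectiveLimit_infinitePi fun _ : ι => μ.prod ν).unique fun I => ?_).symm
  refine (Measure.pi_eq_generateFrom
    (C := fun _ => image2 (· ×ˢ ·) {s : Set X | MeasurableSet s} {t : Set Y | MeasurableSet t})
    (fun _ => generateFrom_prod) (fun _ => isPiSystem_prod)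
    (fun _ => μ.toFiniteSpanningSetsIn.prod ν.toFiniteSpanningSetsIn) fun s hs => ?_).symm
  choose A hA B hB hAB using hs
  simp only [mem_ofPred_eq] at hA hB
  classical
  let A' : ι → Set X := fun i => if h : i ∈ I then A ⟨i, h⟩ else univ
  let B' : ι → Set Y := fun i => if h : i ∈ I then B ⟨i, h⟩ else univ
  have hA' : ∀ i, MeasurableSet (A' i) := fun i => by
    by_cases h : i ∈ I <;> simp [A', h, hA]
  have hB' : ∀ i, MeasurableSet (B' i) := fun i => by
    by_cases h : i ∈ I <;> simp [B', h, hB]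
  have hs : ∀ i, MeasurableSet (s i) := fun i => by
    rw [← hAB i]
    exact (hA i).prod (hB i)
  rw [Measure.map_apply (by fun_prop) (.univ_pi hs), Measure.map_apply (by fun_prop)
    (measurableSet_preimage (by fun_prop) (.univ_pi hs))]
  have : (fun (p : (ι → X) × (ι → Y)) (i : ι) => (p.1 i, p.2 i)) ⁻¹'
      (I.restrict ⁻¹' univ.pi s) = (Set.pi I A') ×ˢ (Set.pi I B') := by
    ext p
    simp only [mem_preimage, Set.mem_pi, mem_univ, true_imp_iff, mem_prod, ← forall_and,
      Finset.mem_coe, Subtype.forall, Finset.restrict]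
    refine forall₂_congr fun i hi => ?_
    rw [← hAB]
    simp [A', B', hi]
  rw [this, Measure.prod_prod, Measure.infinitePi_pi _ (fun i _ => hA' i),
    Measure.infinitePi_pi _ (fun i _ => hB' i), ← Finset.prod_mul_distrib,
    ← Finset.prod_coe_sort]
  refine Finset.prod_congr rfl fun i _ => ?_
  rw [← hAB i, Measure.prod_prod]
  simp [A', B']

variable {X : Type*}

/-- Put together a family of labels from the label of the root and from those of the branches. -/
def graft (p : X × (ℕ → Label → X)) (v : Label) : X :=
  if h : v = [] then p.1 else p.2 (v.getLast h) v.dropLast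

@[simp] theorem graft_nil (p : X × (ℕ → Label → X)) : graft p [] = p.1 := rfl

@[simp] theorem graft_append (p : X × (ℕ → Label → X)) (w : Label) (j : ℕ) :
    graft p (w ++ [j]) = p.2 j w := by
  simp [graft]

theorem measurable_graft [MeasurableSpace X] :
    Measurable (graft : X × (ℕ → Label → X) → Label → X) := by
  refine measurable_pi_lambda _ fun v => ?_
  by_cases h : v = []
  · simp only [graft, h, dif_pos]
    exact measurable_fst
  · simp only [graft, h, dif_neg, not_false_eq_true]
    fun_prop

/-- This is the independence of the root and its branches. Labels grow at the head, so the last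
entry names the branch at the root, and a cylinder splits according to that entry. -/
theorem map_graft [MeasurableSpace X] (μ : Measure X) [IsProbabilityMeasure μ] :
    (μ.prod (Measure.infinitePi fun _ : ℕ => Measure.infinitePi fun _ : Label => μ)).map graft =
      Measure.infinitePi fun _ : Label => μ := by
  classical
  refine Measure.eq_infinitePi _ fun s t ht => ?_
  have inj (j : ℕ) : Function.Injective fun w : Label => w ++ [j] :=
    List.append_left_injective [j]
  let sj (j : ℕ) : Finset Label := s.preimage (fun w => w ++ [j]) (inj j).injOn
  -- The default `0` arises only from the label `[]`. It may add a branch without constraints, which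
  -- contributes a factor 1.
  let J : Finset ℕ := s.image fun v => v.getLastD 0
  have hpre : graft ⁻¹' Set.pi s t = ({x : X | [] ∈ s → x ∈ t []}) ×ˢ
      Set.pi (J : Set ℕ) fun j => Set.pi (sj j : Set Label) fun w => t (w ++ [j]) := by
    ext p
    simp only [mem_preimage, Set.mem_pi, mem_prod, Finset.mem_coe, mem_ofPred_eq]
    constructor
    · refine fun h => ⟨fun h0 => h [] h0, fun j _ w hw => ?_⟩
      simpa using h (w ++ [j]) (by simpa [sj] using hw)
    · rintro ⟨h0, h1⟩ v hv
      rcases v.eq_nil_or_concat with rfl | ⟨w, j, rfl⟩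
      · exact h0 hv
      · rw [List.concat_eq_append] at hv ⊢
        rw [graft_append]
        exact h1 j (Finset.mem_image.2 ⟨_, hv, by simp⟩) w (by simpa [sj] using hv)
  have hm : ∀ j, MeasurableSet (Set.pi (sj j : Set Label) fun w => t (w ++ [j])) := fun j =>
    MeasurableSet.pi (Finset.countable_toSet _) fun w _ => ht _
  rw [Measure.map_apply measurable_graft (.pi s.countable_toSet fun v _ => ht v), hpre,
    Measure.prod_prod, Measure.infinitePi_pi _ fun j _ => hm j]
  simp_rw [Measure.infinitePi_pi (fun _ : Label => μ) fun w _ => ht _]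
  have hs : ∏ i ∈ s, μ (t i) = (∏ i ∈ s with i = [], μ (t i)) * ∏ i ∈ s with ¬ i = [], μ (t i) :=
    (Finset.prod_filter_mul_prod_filter_not s _ _).symm
  rw [hs]
  congr 1
  · by_cases h : [] ∈ s
    · have : s.filter (fun i => i = []) = {[]} := by ext; aesop
      simp [h, this]
    · have : s.filter (fun i => i = []) = ∅ := by ext; aesop
      simp [h, this]
  · rw [Finset.prod_sigma']
    refine Finset.prod_bij (fun x _ => x.2 ++ [x.1]) ?_ ?_ ?_ ?_
    · rintro ⟨j, w⟩ h
      simp only [Finset.mem_sigma, sj, Finset.mem_preimage] at h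
      simp [h.2]
    · rintro ⟨j, w⟩ _ ⟨j', w'⟩ _ h
      obtain ⟨rfl, h⟩ := List.append_inj' h rfl
      simp_all
    · intro v hv
      rw [Finset.mem_filter] at hv
      rcases v.eq_nil_or_concat with rfl | ⟨w, j, rfl⟩
      · exact absurd rfl hv.2
      · rw [List.concat_eq_append] at hv ⊢
        refine ⟨⟨j, w⟩, ?_, rfl⟩
        simp only [Finset.mem_sigma, sj, Finset.mem_preimage]
        exact ⟨Finset.mem_image.2 ⟨_, hv.1, by simp⟩, hv.1⟩
    · exact fun _ _ => rfl

/-! ### Recursion for the truncated parking probabilities -/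

/-- The law of the degree and the arrival time of a single site. -/
def siteLaw (a : PMF ℕ) : Measure (ℕ × ℝ) := a.toMeasure.prod (expMeasure 1)

/-- The joint law of all degrees and arrival times. -/
def jointLaw (a : PMF ℕ) : Measure (Label → ℕ × ℝ) := Measure.infinitePi fun _ => siteLaw a

instance : IsProbabilityMeasure (expMeasure 1) := isProbabilityMeasure_expMeasure one_pos

instance (a : PMF ℕ) : IsProbabilityMeasure (siteLaw a) := by unfold siteLaw; infer_instance

instance (a : PMF ℕ) : IsProbabilityMeasure (jointLaw a) := by unfold jointLaw; infer_instance

instance (a : PMF ℕ) : IsProbabilityMeasure (treeLaw a) := by unfold treeLaw; infer_instance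

instance (V : Type*) : IsProbabilityMeasure (arrivalLaw V) := by
  unfold arrivalLaw; infer_instance

theorem map_zip_eq_jointLaw (a : PMF ℕ) :
    ((treeLaw a).prod (arrivalLaw Label)).map (fun p v => (p.1 v, p.2 v)) = jointLaw a :=
  infinitePi_map_zip _ _

/-- Child numbers: `f (degree)` at the root and `degree - 1` elsewhere. -/
def childNum (f : ℕ → ℕ) (ω : Label → ℕ × ℝ) : Label → ℕ
  | [] => f (ω []).1
  | j :: v => (ω (j :: v)).1 - 1

theorem childNum_id (ω : Label → ℕ × ℝ) : childNum id ω = numChildren fun v => (ω v).1 := by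
  funext v
  cases v <;> rfl

/-- The event that the root is accepted by the `n`-th truncation. -/
def winSet (f : ℕ → ℕ) (n : ℕ) : Set (Label → ℕ × ℝ) :=
  {ω | Wins (childNum f ω) (fun v => (ω v).2) n []}

theorem wins_shift {c c' : Label → ℕ} {T : Label → ℝ} (v : Label)
    (h : ∀ w, c (w ++ v) = c' w) (n : ℕ) :
    ∀ w, Wins c T n (w ++ v) ↔ Wins c' (fun w => T (w ++ v)) n w := by
  induction n with
  | zero => exact fun _ => Iff.rfl
  | succ n ih =>
    intro w
    simp only [Wins, h w, ← List.cons_append, ih]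

/-- Outside the root, winning is the event `winSet` for the branch. -/
theorem wins_append_iff (f : ℕ → ℕ) (ω : Label → ℕ × ℝ) (n : ℕ) (i : ℕ) (v : Label) :
    Wins (childNum f ω) (fun v => (ω v).2) n (i :: v) ↔
      (fun w => ω (w ++ i :: v)) ∈ winSet Nat.pred n := by
  refine wins_shift (i :: v) (fun w => ?_) n []
  cases w <;> rfl

theorem measurableSet_wins (f : ℕ → ℕ) (n : ℕ) (v : Label) :
    MeasurableSet {ω | Wins (childNum f ω) (fun v => (ω v).2) n v} := by
  induction n generalizing v with
  | zero => exact MeasurableSet.univ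
  | succ n ih =>
    have hc : Measurable fun ω : Label → ℕ × ℝ => childNum f ω v := by
      cases v with
      | nil => exact (Measurable.of_discrete (f := f)).comp (by fun_prop)
      | cons j v =>
        exact (Measurable.of_discrete (f := Nat.pred)).comp
          (measurable_fst.comp (measurable_pi_apply (j :: v)))
    simp only [Wins, ofPred_forall]
    refine MeasurableSet.iInter fun j => ?_
    exact (measurableSet_lt measurable_const hc).imp
      ((measurableSet_lt (by fun_prop) (by fun_prop)).imp (ih _).compl)

theorem measurableSet_winSet (f : ℕ → ℕ) (n : ℕ) : MeasurableSet (winSet f n) :=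
  measurableSet_wins f n []

/-- The probability that the root of a branch arrives before `r` and is accepted by the `n`-th
truncation. -/
def winProb (a : PMF ℕ) (n : ℕ) (r : ℝ) : ℝ :=
  (jointLaw a).real ({ω | (ω []).2 < r} ∩ winSet Nat.pred n)

theorem winProb_mono (a : PMF ℕ) (n : ℕ) : Monotone (winProb a n) := fun _ _ h =>
  measureReal_mono (inter_subset_inter_left _ fun _ hω => lt_of_lt_of_le hω h)

theorem measurableSet_lt_inter_winSet (f : ℕ → ℕ) (n : ℕ) (s : ℝ) :
    MeasurableSet ({ω : Label → ℕ × ℝ | (ω []).2 < s} ∩ winSet f n) :=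
  (measurableSet_lt (by fun_prop) measurable_const).inter (measurableSet_winSet f n)

/-- Once the degree and arrival time of the root are fixed, winning becomes a separate condition on
each branch; independence then produces a power of `1 - winProb a n r`. -/
theorem preimage_graft_winSet (f : ℕ → ℕ) (n : ℕ) {s r : ℝ} (hr : r < s) (k : ℕ) :
    Prod.mk (k, r) ⁻¹' (graft ⁻¹' ({ω | (ω []).2 < s} ∩ winSet f (n + 1))) =
      Set.pi (Finset.range (f k) : Set ℕ)
        fun _ => ({ω : Label → ℕ × ℝ | (ω []).2 < r} ∩ winSet Nat.pred n)ᶜ := by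
  ext y
  simp only [mem_preimage, mem_inter_iff, mem_ofPred_eq, graft_nil, hr, true_and, Set.mem_pi,
    Finset.coe_range, mem_Iio, mem_compl_iff, not_and]
  change (∀ j < f k, (graft ((k, r), y) ([] ++ [j])).2 < r → ¬ _) ↔ _
  refine forall₂_congr fun j _ => ?_
  rw [graft_append]
  refine imp_congr Iff.rfl (not_congr ?_)
  rw [wins_append_iff]
  simp [graft_append]

theorem measure_winSet_succ (a : PMF ℕ) (f : ℕ → ℕ) (n : ℕ) (s : ℝ) :
    jointLaw a ({ω | (ω []).2 < s} ∩ winSet f (n + 1)) =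
      ∫⁻ r in Iio s, ∑' k, ENNReal.ofReal ((1 - winProb a n r) ^ f k) * a k ∂(expMeasure 1) := by
  have hE := measurableSet_lt_inter_winSet f (n + 1) s
  have hslice (k : ℕ) (r : ℝ) :
      (Measure.infinitePi fun _ : ℕ => jointLaw a) (Prod.mk (k, r) ⁻¹'
        (graft ⁻¹' ({ω | (ω []).2 < s} ∩ winSet f (n + 1)))) =
      (Iio s).indicator (fun r => ENNReal.ofReal ((1 - winProb a n r) ^ f k)) r := by
    by_cases hr : r < s
    · rw [preimage_graft_winSet f n hr, Measure.infinitePi_pi _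
        fun _ _ => (measurableSet_lt_inter_winSet _ _ _).compl, Finset.prod_const,
        Finset.card_range, indicator_of_mem (show r ∈ Iio s from hr),
        winProb, ENNReal.ofReal_pow (sub_nonneg.2 measureReal_le_one),
        ← probReal_compl_eq_one_sub (measurableSet_lt_inter_winSet _ _ _), ofReal_measureReal]
    · rw [indicator_of_notMem (show r ∉ Iio s from hr)]
      refine (congrArg _ (eq_empty_of_forall_notMem fun y hy => ?_)).trans measure_empty
      exact hr hy.1
  rw [jointLaw, ← map_graft, Measure.map_apply measurable_graft hE,
    Measure.prod_apply (measurable_graft hE)]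
  change ∫⁻ x, (Measure.infinitePi fun _ : ℕ => jointLaw a) _ ∂(siteLaw a) = _
  rw [siteLaw, lintegral_prod_symm _
    (measurable_measure_prodMk_left (measurable_graft hE)).aemeasurable,
    ← lintegral_indicator measurableSet_Iio]
  refine lintegral_congr fun r => ?_
  rw [lintegral_countable']
  simp_rw [hslice, PMF.toMeasure_apply_singleton a _ (measurableSet_singleton _)]
  by_cases hr : r ∈ Iio s <;> simp [hr]

/-! ### Power series with the coefficients of a probability distribution -/

/-- The series `∑ a_k x^(f k)`. -/
def powSum (a : PMF ℕ) (f : ℕ → ℕ) (x : ℝ) : ℝ := ∑' k, (a k).toReal * x ^ f k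

theorem summable_pmf_toReal (a : PMF ℕ) : Summable fun k => (a k).toReal :=
  ENNReal.summable_toReal (a.tsum_coe ▸ ENNReal.one_ne_top)

theorem tsum_pmf_toReal (a : PMF ℕ) : ∑' k, (a k).toReal = 1 := by
  rw [← ENNReal.tsum_toReal_eq fun k => a.apply_ne_top k, a.tsum_coe, ENNReal.toReal_one]

variable {a : PMF ℕ} {f : ℕ → ℕ}

theorem powSum_term_le {x : ℝ} (hx : x ∈ Icc (0 : ℝ) 1) (k : ℕ) :
    (a k).toReal * x ^ f k ≤ (a k).toReal :=
  mul_le_of_le_one_right ENNReal.toReal_nonneg (pow_le_one₀ hx.1 hx.2)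

theorem powSum_term_nonneg {x : ℝ} (hx : 0 ≤ x) (k : ℕ) : 0 ≤ (a k).toReal * x ^ f k :=
  mul_nonneg ENNReal.toReal_nonneg (pow_nonneg hx _)

theorem summable_powSum {x : ℝ} (hx : x ∈ Icc (0 : ℝ) 1) :
    Summable fun k => (a k).toReal * x ^ f k :=
  .of_nonneg_of_le (powSum_term_nonneg hx.1) (powSum_term_le hx) (summable_pmf_toReal a)

theorem powSum_nonneg {x : ℝ} (hx : 0 ≤ x) : 0 ≤ powSum a f x :=
  tsum_nonneg (powSum_term_nonneg hx)

theorem powSum_le_one {x : ℝ} (hx : x ∈ Icc (0 : ℝ) 1) : powSum a f x ≤ 1 :=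
  ((summable_powSum hx).tsum_le_tsum (powSum_term_le hx) (summable_pmf_toReal a)).trans_eq
    (tsum_pmf_toReal a)

theorem powSum_mono {x y : ℝ} (hx : 0 ≤ x) (hxy : x ≤ y) (hy : y ≤ 1) :
    powSum a f x ≤ powSum a f y :=
  (summable_powSum ⟨hx, hxy.trans hy⟩).tsum_le_tsum
    (fun _ => mul_le_mul_of_nonneg_left (pow_le_pow_left₀ hx hxy _) ENNReal.toReal_nonneg)
    (summable_powSum ⟨hx.trans hxy, hy⟩)

theorem powSum_pos {x : ℝ} (hx : x ∈ Ioc (0 : ℝ) 1) : 0 < powSum a f x := by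
  obtain ⟨k, hk⟩ := a.support_nonempty
  refine (summable_powSum ⟨hx.1.le, hx.2⟩).tsum_pos (powSum_term_nonneg hx.1.le) k ?_
  exact mul_pos (ENNReal.toReal_pos ((a.mem_support_iff k).1 hk) (a.apply_ne_top k))
    (pow_pos hx.1 _)

theorem continuousOn_powSum : ContinuousOn (powSum a f) (Icc 0 1) := by
  refine continuousOn_tsum (fun _ => by fun_prop) (summable_pmf_toReal a) fun k x hx => ?_
  rw [Real.norm_of_nonneg (powSum_term_nonneg hx.1 k)]
  exact powSum_term_le hx k

/-- The exponent `Nat.pred` counts the children of a vertex other than 0. The identity would fail at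
`k = 0`, where `Nat.pred 0 = 0`, but that coefficient vanishes. -/
theorem genFun_eq_mul (ha : ∀ k < 2, a k = 0) (x : ℝ) :
    genFun a x = x * powSum a Nat.pred x := by
  rw [genFun, powSum, ← tsum_mul_left]
  refine tsum_congr fun k => ?_
  rcases lt_or_ge k 2 with h | h
  · simp [ha k h]
  · obtain ⟨m, rfl⟩ : ∃ m, k = m + 1 := ⟨k - 1, by omega⟩
    simp only [Nat.pred_succ, pow_succ]
    ring

theorem powSum_pred_le (ha : ∀ k < 2, a k = 0) {x : ℝ} (hx : x ∈ Icc (0 : ℝ) 1) :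
    powSum a Nat.pred x ≤ x := by
  have h : HasSum (fun k => (a k).toReal * x) x := by
    simpa [tsum_pmf_toReal a] using (summable_pmf_toReal a).hasSum.mul_right x
  refine ((summable_powSum hx).tsum_le_tsum (fun k => ?_) h.summable).trans_eq h.tsum_eq
  rcases lt_or_ge k 2 with hk | hk
  · simp [ha k hk]
  · refine mul_le_mul_of_nonneg_left (pow_le_of_le_one hx.1 hx.2 ?_) ENNReal.toReal_nonneg
    rw [Nat.pred_eq_sub_one]
    omega

theorem ofReal_powSum {x : ℝ} (hx : x ∈ Icc (0 : ℝ) 1) :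
    ∑' k, ENNReal.ofReal (x ^ f k) * a k = ENNReal.ofReal (powSum a f x) := by
  rw [powSum, ENNReal.ofReal_tsum_of_nonneg (powSum_term_nonneg hx.1) (summable_powSum hx)]
  refine tsum_congr fun k => ?_
  rw [ENNReal.ofReal_mul ENNReal.toReal_nonneg, ENNReal.ofReal_toReal (a.apply_ne_top k), mul_comm]

/-- Monotonicity supplies measurability and integrability of the integrands before any continuity is
known. -/
theorem antitone_powSum_one_sub {F : ℝ → ℝ} (hF : Monotone F) (hF' : ∀ r, F r ∈ Icc (0 : ℝ) 1) :
    Antitone fun r => powSum a f (1 - F r) := fun r s h =>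
  powSum_mono (sub_nonneg.2 (hF' s).2) (sub_le_sub_left (hF h) 1) (sub_le_self _ (hF' r).1)

/-! ### The limits of the truncated parking probabilities -/

theorem one_sub_mem_Icc {x : ℝ} (hx : x ∈ Icc (0 : ℝ) 1) : 1 - x ∈ Icc (0 : ℝ) 1 :=
  ⟨sub_nonneg.2 hx.2, sub_le_self _ hx.1⟩

theorem winProb_mem (a : PMF ℕ) (n : ℕ) (r : ℝ) : winProb a n r ∈ Icc (0 : ℝ) 1 :=
  ⟨measureReal_nonneg, measureReal_le_one⟩

theorem real_winSet_succ (a : PMF ℕ) (f : ℕ → ℕ) (n : ℕ) (s : ℝ) :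
    (jointLaw a).real ({ω | (ω []).2 < s} ∩ winSet f (n + 1)) =
      ∫ r in Iio s, powSum a f (1 - winProb a n r) ∂(expMeasure 1) := by
  rw [measureReal_def, measure_winSet_succ, integral_eq_lintegral_of_nonneg_ae]
  · simp_rw [ofReal_powSum (one_sub_mem_Icc (winProb_mem a n _))]
  · exact ae_of_all _ fun r => powSum_nonneg (one_sub_mem_Icc (winProb_mem a n r)).1
  · exact (antitone_powSum_one_sub (winProb_mono a n)
      (winProb_mem a n)).measurable.aestronglyMeasurable

/-- The probability that the root arrives before `s` and wins all even truncations. -/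
def upperProb (a : PMF ℕ) (f : ℕ → ℕ) (s : ℝ) : ℝ :=
  (jointLaw a).real ({ω | (ω []).2 < s} ∩ ⋂ n, winSet f (2 * n))

/-- The probability that the root arrives before `s` and wins some odd truncation. -/
def lowerProb (a : PMF ℕ) (f : ℕ → ℕ) (s : ℝ) : ℝ :=
  (jointLaw a).real ({ω | (ω []).2 < s} ∩ ⋃ n, winSet f (2 * n + 1))

theorem upperProb_mem (a : PMF ℕ) (f : ℕ → ℕ) (s : ℝ) : upperProb a f s ∈ Icc (0 : ℝ) 1 :=
  ⟨measureReal_nonneg, measureReal_le_one⟩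

theorem lowerProb_mem (a : PMF ℕ) (f : ℕ → ℕ) (s : ℝ) : lowerProb a f s ∈ Icc (0 : ℝ) 1 :=
  ⟨measureReal_nonneg, measureReal_le_one⟩

theorem upperProb_mono (a : PMF ℕ) (f : ℕ → ℕ) : Monotone (upperProb a f) := fun _ _ h =>
  measureReal_mono (inter_subset_inter_left _ fun _ hω => lt_of_lt_of_le hω h)

theorem lowerProb_mono (a : PMF ℕ) (f : ℕ → ℕ) : Monotone (lowerProb a f) := fun _ _ h =>
  measureReal_mono (inter_subset_inter_left _ fun _ hω => lt_of_lt_of_le hω h)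

theorem antitone_winSet_even (f : ℕ → ℕ) : Antitone fun n => winSet f (2 * n) :=
  antitone_nat_of_succ_le fun _ ω (h : Wins (childNum f ω) _ _ []) => Wins.odd_mono.2 h

theorem monotone_winSet_odd (f : ℕ → ℕ) : Monotone fun n => winSet f (2 * n + 1) :=
  monotone_nat_of_le_succ fun _ ω (h : Wins (childNum f ω) _ _ []) => Wins.odd_mono.1 h

theorem tendsto_upperProb (a : PMF ℕ) (f : ℕ → ℕ) (s : ℝ) :
    Tendsto (fun n => (jointLaw a).real ({ω | (ω []).2 < s} ∩ winSet f (2 * n))) atTop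
      (𝓝 (upperProb a f s)) := by
  rw [upperProb, inter_iInter]
  refine (ENNReal.tendsto_toReal (measure_ne_top _ _)).comp (tendsto_measure_iInter_atTop
    (fun n => (measurableSet_lt_inter_winSet f _ s).nullMeasurableSet)
    (fun m n h => inter_subset_inter_right _ (antitone_winSet_even f h))
    ⟨0, measure_ne_top _ _⟩)

theorem tendsto_lowerProb (a : PMF ℕ) (f : ℕ → ℕ) (s : ℝ) :
    Tendsto (fun n => (jointLaw a).real ({ω | (ω []).2 < s} ∩ winSet f (2 * n + 1))) atTop
      (𝓝 (lowerProb a f s)) := by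
  rw [lowerProb, inter_iUnion]
  exact (ENNReal.tendsto_toReal (measure_ne_top _ _)).comp (tendsto_measure_iUnion_atTop
    fun m n h => inter_subset_inter_right _ (monotone_winSet_odd f h))

theorem tendsto_integral_powSum (a : PMF ℕ) (f : ℕ → ℕ) (s : ℝ) {m : ℕ → ℕ} {F : ℝ → ℝ}
    (hF : ∀ r, F r ∈ Icc (0 : ℝ) 1)
    (h : ∀ r, Tendsto (fun n => winProb a (m n) r) atTop (𝓝 (F r))) :
    Tendsto (fun n => ∫ r in Iio s, powSum a f (1 - winProb a (m n) r) ∂(expMeasure 1)) atTop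
      (𝓝 (∫ r in Iio s, powSum a f (1 - F r) ∂(expMeasure 1))) := by
  refine tendsto_integral_of_dominated_convergence (fun _ => 1) (fun n => ?_)
    (integrable_const _) (fun n => ae_of_all _ fun r => ?_) (ae_of_all _ fun r => ?_)
  · exact (antitone_powSum_one_sub (winProb_mono a _)
      (winProb_mem a _)).measurable.aestronglyMeasurable
  · have := one_sub_mem_Icc (winProb_mem a (m n) r)
    rw [Real.norm_of_nonneg (powSum_nonneg this.1)]
    exact powSum_le_one this
  · exact (continuousOn_powSum _ (one_sub_mem_Icc (hF r))).tendsto.comp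
      (tendsto_nhdsWithin_iff.2 ⟨(h r).const_sub 1,
        Eventually.of_forall fun n => one_sub_mem_Icc (winProb_mem a (m n) r)⟩)

theorem upperProb_eq_setIntegral (a : PMF ℕ) (f : ℕ → ℕ) (s : ℝ) :
    upperProb a f s = ∫ r in Iio s, powSum a f (1 - lowerProb a Nat.pred r) ∂(expMeasure 1) := by
  -- The shift drops the trivial truncation at depth 0; since 2(n+1) = (2n+1)+1, the branches are
  -- then truncated at odd depth.
  refine tendsto_nhds_unique ((tendsto_upperProb a f s).comp (tendsto_add_atTop_nat 1)) ?_
  refine (tendsto_integral_powSum a f s (lowerProb_mem a _) (tendsto_lowerProb a _)).congr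
    fun n => (real_winSet_succ a f (2 * n + 1) s).symm

theorem lowerProb_eq_setIntegral (a : PMF ℕ) (f : ℕ → ℕ) (s : ℝ) :
    lowerProb a f s = ∫ r in Iio s, powSum a f (1 - upperProb a Nat.pred r) ∂(expMeasure 1) := by
  refine tendsto_nhds_unique (tendsto_lowerProb a f s) ?_
  refine (tendsto_integral_powSum a f s (upperProb_mem a _) (tendsto_upperProb a _)).congr
    fun n => (real_winSet_succ a f (2 * n) s).symm

theorem setIntegral_Iio_expMeasure (h : ℝ → ℝ) {s : ℝ} (hs : 0 ≤ s) :
    ∫ r in Iio s, h r ∂(expMeasure 1) = ∫ r in 0..s, Real.exp (-r) * h r := by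
  have hd : expMeasure 1 = volume.withDensity (exponentialPDF 1) := rfl
  have hm : Measurable (exponentialPDF 1) := (measurable_exponentialPDFReal 1).ennreal_ofReal
  rw [hd, setIntegral_withDensity_eq_setIntegral_toReal_smul hm
    (ae_of_all _ fun r => ENNReal.ofReal_lt_top) _ measurableSet_Iio,
    intervalIntegral.integral_of_le hs, integral_Ioc_eq_integral_Ioo,
    ← integral_Ico_eq_integral_Ioo,
    ← Iio_inter_Ici, ← integral_indicator measurableSet_Iio,
    ← integral_indicator (measurableSet_Iio.inter measurableSet_Ici)]
  refine integral_congr_ae (ae_of_all _ fun r => ?_)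
  by_cases h1 : r < s <;> by_cases h2 : 0 ≤ r <;>
    simp [indicator, h1, h2, exponentialPDF_eq, ENNReal.toReal_ofReal (Real.exp_pos _).le]

theorem upperProb_eq (a : PMF ℕ) (f : ℕ → ℕ) {s : ℝ} (hs : 0 ≤ s) :
    upperProb a f s = ∫ r in 0..s, Real.exp (-r) * powSum a f (1 - lowerProb a Nat.pred r) := by
  rw [upperProb_eq_setIntegral, setIntegral_Iio_expMeasure _ hs]

theorem lowerProb_eq (a : PMF ℕ) (f : ℕ → ℕ) {s : ℝ} (hs : 0 ≤ s) :
    lowerProb a f s = ∫ r in 0..s, Real.exp (-r) * powSum a f (1 - upperProb a Nat.pred r) := by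
  rw [lowerProb_eq_setIntegral, setIntegral_Iio_expMeasure _ hs]

theorem intervalIntegrable_exp_mul_powSum {F : ℝ → ℝ} (hF : Monotone F)
    (hF' : ∀ r, F r ∈ Icc (0 : ℝ) 1) (s t : ℝ) :
    IntervalIntegrable (fun r => Real.exp (-r) * powSum a f (1 - F r)) volume s t :=
  (antitone_powSum_one_sub hF hF').intervalIntegrable.continuousOn_mul (by fun_prop)

theorem integral_exp_neg (s : ℝ) : ∫ r in 0..s, Real.exp (-r) = 1 - Real.exp (-s) := by
  simp

/-- Strictness comes from the mass e^(-s) of later arrivals. It keeps `1 - upperProb a Nat.pred s`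
away from the singularity of x/G(x) at 0. -/
theorem integral_exp_mul_powSum_lt_one {F : ℝ → ℝ} (hF : Monotone F)
    (hF' : ∀ r, F r ∈ Icc (0 : ℝ) 1) {s : ℝ} (hs : 0 ≤ s) :
    ∫ r in 0..s, Real.exp (-r) * powSum a f (1 - F r) < 1 := by
  refine lt_of_le_of_lt ?_ (sub_lt_self 1 (Real.exp_pos (-s)))
  rw [← integral_exp_neg]
  refine intervalIntegral.integral_mono_on hs (intervalIntegrable_exp_mul_powSum hF hF' _ _)
    (Continuous.intervalIntegrable (by fun_prop) _ _) fun r _ => ?_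
  exact mul_le_of_le_one_right (Real.exp_pos _).le (powSum_le_one (one_sub_mem_Icc (hF' r)))

/-! ### Solving the integral equations -/

/-- Change of variables along a function given as an integral from `0`. -/
theorem integral_comp_mul_of_eq_integral {F φ h : ℝ → ℝ}
    (hF : ∀ s, 0 ≤ s → F s = ∫ r in 0..s, φ r) {s : ℝ} (hs : 0 ≤ s)
    (hφ : ContinuousOn φ (Icc 0 s)) (hh : ContinuousOn h (F '' Icc 0 s)) :
    ∫ r in 0..s, h (F r) * φ r = ∫ x in 0..F s, h x := by
  have hF0 : F 0 = 0 := by rw [hF 0 le_rfl, intervalIntegral.integral_same]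
  have hu : uIcc 0 s = Icc 0 s := uIcc_of_le hs
  have hcont : ContinuousOn F (Icc 0 s) := by
    have := intervalIntegral.continuousOn_primitive_interval (μ := volume)
      (f := φ) (a := 0) (b := s) (by rw [hu]; exact hφ.integrableOn_Icc)
    rw [hu] at this
    exact this.congr fun r hr => hF r hr.1
  have := intervalIntegral.integral_comp_mul_deriv'' (f := F) (f' := φ) (g := h) (a := 0) (b := s)
    (by rwa [hu]) (fun r hr => ?_) (by rwa [hu]) (by rwa [hu])
  · simpa [hF0] using this
  · rw [min_eq_left hs, max_eq_right hs] at hr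
    have hn : Icc 0 s ∈ 𝓝 r := Icc_mem_nhds hr.1 hr.2
    have hd : HasDerivAt (fun s => ∫ r in 0..s, φ r) (φ r) r := by
      refine intervalIntegral.integral_hasDerivAt_right
        ((hφ.mono (Icc_subset_Icc_right hr.2.le)).intervalIntegrable_of_Icc hr.1.le) ?_
        (hφ.continuousAt hn)
      exact ⟨_, hn, hφ.aestronglyMeasurable measurableSet_Icc⟩
    refine (hd.congr_of_eventuallyEq ?_).hasDerivWithinAt
    filter_upwards [hn] with t ht using hF t ht.1

theorem continuousOn_of_eq_integral {F φ : ℝ → ℝ} (hF : ∀ s, 0 ≤ s → F s = ∫ r in 0..s, φ r)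
    (hφ : ∀ s t, IntervalIntegrable φ volume s t) : ContinuousOn F (Ici 0) :=
  ((intervalIntegral.continuous_primitive hφ 0).continuousOn).congr fun s hs => hF s hs

theorem continuousOn_upperProb (a : PMF ℕ) (f : ℕ → ℕ) : ContinuousOn (upperProb a f) (Ici 0) :=
  continuousOn_of_eq_integral (fun _ => upperProb_eq a f)
    (intervalIntegrable_exp_mul_powSum (lowerProb_mono a _) (lowerProb_mem a _))

theorem continuousOn_lowerProb (a : PMF ℕ) (f : ℕ → ℕ) : ContinuousOn (lowerProb a f) (Ici 0) :=
  continuousOn_of_eq_integral (fun _ => lowerProb_eq a f)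
    (intervalIntegrable_exp_mul_powSum (upperProb_mono a _) (upperProb_mem a _))

theorem continuousOn_exp_mul_powSum {F : ℝ → ℝ} (hF : ContinuousOn F (Ici 0))
    (hF' : ∀ r, F r ∈ Icc (0 : ℝ) 1) :
    ContinuousOn (fun r => Real.exp (-r) * powSum a f (1 - F r)) (Ici 0) :=
  ContinuousOn.mul (by fun_prop)
    (continuousOn_powSum.comp (continuousOn_const.sub hF) fun r _ => one_sub_mem_Icc (hF' r))

theorem upperProb_lt_one (a : PMF ℕ) (f : ℕ → ℕ) {s : ℝ} (hs : 0 ≤ s) : upperProb a f s < 1 := by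
  rw [upperProb_eq a f hs]
  exact integral_exp_mul_powSum_lt_one (lowerProb_mono a _) (lowerProb_mem a _) hs

theorem lowerProb_le_upperProb (a : PMF ℕ) (f : ℕ → ℕ) (s : ℝ) :
    lowerProb a f s ≤ upperProb a f s := by
  refine measureReal_mono (inter_subset_inter_right _ (iUnion_subset fun n => ?_))
  exact subset_iInter fun m ω hω => Wins.even_of_odd hω

/-- With g = `powSum a Nat.pred`, both ∫₀^U g(1-x) dx and ∫₀^L g(1-x) dx equal the integral of the
symmetric expression e^(-r) g(1-U) g(1-L). Positivity of g(1-x) for x < 1 excludes L < U. -/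
theorem lowerProb_pred_eq (a : PMF ℕ) {s : ℝ} (hs : 0 ≤ s) :
    lowerProb a Nat.pred s = upperProb a Nat.pred s := by
  have hh : ContinuousOn (fun x => powSum a Nat.pred (1 - x)) (Icc 0 1) :=
    continuousOn_powSum.comp (by fun_prop) fun x hx => one_sub_mem_Icc hx
  have h1 := integral_comp_mul_of_eq_integral (fun _ => upperProb_eq a Nat.pred) hs
    ((continuousOn_exp_mul_powSum (continuousOn_lowerProb a _) (lowerProb_mem a _)).mono
      Icc_subset_Ici_self) (hh.mono (image_subset_iff.2 fun r _ => upperProb_mem a _ r))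
  have h2 := integral_comp_mul_of_eq_integral (fun _ => lowerProb_eq a Nat.pred) hs
    ((continuousOn_exp_mul_powSum (continuousOn_upperProb a _) (upperProb_mem a _)).mono
      Icc_subset_Ici_self) (hh.mono (image_subset_iff.2 fun r _ => lowerProb_mem a _ r))
  have h3 : ∫ x in 0..upperProb a Nat.pred s, powSum a Nat.pred (1 - x) =
      ∫ x in 0..lowerProb a Nat.pred s, powSum a Nat.pred (1 - x) := by
    rw [← h1, ← h2]
    congr 1
    funext r
    ring
  refine (lowerProb_le_upperProb a _ s).eq_of_not_lt fun hlt => ?_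
  have hi (x y : ℝ) (hx : x ∈ Icc (0 : ℝ) 1) (hy : y ∈ Icc (0 : ℝ) 1) :
      IntervalIntegrable (fun x => powSum a Nat.pred (1 - x)) volume x y :=
    (hh.mono (uIcc_subset_Icc hx hy)).intervalIntegrable
  have h0 : (0 : ℝ) ∈ Icc (0 : ℝ) 1 := by simp
  have := intervalIntegral.intervalIntegral_pos_of_pos_on
    (hi _ _ (lowerProb_mem a _ s) (upperProb_mem a _ s)) (fun x hx => powSum_pos
      ⟨sub_pos.2 (hx.2.trans_le (upperProb_mem a _ s).2),
        sub_le_self _ ((lowerProb_mem a _ s).1.trans hx.1.le)⟩) hlt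
  rw [← intervalIntegral.integral_interval_sub_left (hi _ _ h0 (upperProb_mem a _ s))
    (hi _ _ h0 (lowerProb_mem a _ s)), h3, sub_self] at this
  exact lt_irrefl _ this

theorem upperProb_pred_eq (a : PMF ℕ) (f : ℕ → ℕ) {s : ℝ} (hs : 0 ≤ s) :
    upperProb a f s = ∫ r in 0..s, Real.exp (-r) * powSum a f (1 - upperProb a Nat.pred r) := by
  rw [upperProb_eq a f hs]
  refine intervalIntegral.integral_congr fun r hr => ?_
  rw [uIcc_of_le hs] at hr
  simp only [lowerProb_pred_eq a hr.1]

theorem lowerProb_eq_upperProb (a : PMF ℕ) (f : ℕ → ℕ) {s : ℝ} (hs : 0 ≤ s) :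
    lowerProb a f s = upperProb a f s := by
  rw [upperProb_pred_eq a f hs, lowerProb_eq a f hs]

theorem continuousOn_div_genFun :
    ContinuousOn (fun x => x / genFun a x) (Ioc 0 1) := by
  refine continuousOn_id.div ((continuousOn_powSum (f := id)).mono Ioc_subset_Icc_self)
    fun x hx => ?_
  exact (powSum_pos (f := id) hx).ne'

/-- Separation of variables: (1-x)/G(1-x) = 1/g(1-x), so at x = U(r) its product with U'(r) is
e^(-r). -/
theorem integral_div_genFun (ha : ∀ k < 2, a k = 0) {s : ℝ} (hs : 0 ≤ s) :
    ∫ x in (1 - upperProb a Nat.pred s)..1, x / genFun a x = 1 - Real.exp (-s) := by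
  have hh : ContinuousOn (fun x => (1 - x) / genFun a (1 - x)) (Ico 0 1) :=
    continuousOn_div_genFun.comp (by fun_prop) fun x hx =>
      ⟨sub_pos.2 hx.2, sub_le_self _ hx.1⟩
  have h1 := integral_comp_mul_of_eq_integral (fun _ => upperProb_pred_eq a Nat.pred) hs
    ((continuousOn_exp_mul_powSum (continuousOn_upperProb a _) (upperProb_mem a _)).mono
      Icc_subset_Ici_self) (hh.mono (image_subset_iff.2 fun r hr =>
        ⟨(upperProb_mem a _ r).1, upperProb_lt_one a _ hr.1⟩))
  rw [intervalIntegral.integral_comp_sub_left (fun x => x / genFun a x) 1, sub_zero] at h1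
  rw [← h1, ← integral_exp_neg]
  refine intervalIntegral.integral_congr fun r hr => ?_
  rw [uIcc_of_le hs] at hr
  have hpos : 0 < 1 - upperProb a Nat.pred r := sub_pos.2 (upperProb_lt_one a _ hr.1)
  have := (powSum_pos (a := a) (f := Nat.pred)
    ⟨hpos, sub_le_self 1 (upperProb_mem a Nat.pred r).1⟩).ne'
  simp only [genFun_eq_mul ha]
  field_simp

theorem upperProb_id_eq (ha : ∀ k < 2, a k = 0) {s : ℝ} (hs : 0 ≤ s) :
    upperProb a id s = (1 - (1 - upperProb a Nat.pred s) ^ 2) / 2 := by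
  have h1 := integral_comp_mul_of_eq_integral (fun _ => upperProb_pred_eq a Nat.pred) hs
    ((continuousOn_exp_mul_powSum (continuousOn_upperProb a _) (upperProb_mem a _)).mono
      Icc_subset_Ici_self) (h := fun x => 1 - x) (by fun_prop)
  rw [upperProb_pred_eq a id hs]
  have h2 : ∫ x in 0..upperProb a Nat.pred s, (1 - x) =
      (1 - (1 - upperProb a Nat.pred s) ^ 2) / 2 := by
    rw [intervalIntegral.integral_sub (by simp) (by simp)]
    simp
    ring
  rw [← h2, ← h1]
  refine intervalIntegral.integral_congr fun r _ => ?_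
  have := genFun_eq_mul ha (1 - upperProb a Nat.pred r)
  change Real.exp (-r) * genFun a (1 - upperProb a Nat.pred r) = _
  rw [this]
  ring

/-! ### The equation for `α` -/

/-- Exponents at least 2 give G(x) ≤ x². This makes the integral defining α diverge at 0. -/
theorem inv_le_div_genFun (ha : ∀ k < 2, a k = 0) {x : ℝ} (hx : x ∈ Ioc (0 : ℝ) 1) :
    x⁻¹ ≤ x / genFun a x := by
  have h := powSum_pos (a := a) (f := Nat.pred) hx
  rw [genFun_eq_mul ha, div_mul_eq_div_div, div_self hx.1.ne', one_div]
  exact inv_anti₀ h (powSum_pred_le ha ⟨hx.1.le, hx.2⟩)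

theorem intervalIntegrable_div_genFun {x y : ℝ} (hx : x ∈ Ioc (0 : ℝ) 1)
    (hy : y ∈ Ioc (0 : ℝ) 1) : IntervalIntegrable (fun x => x / genFun a x) volume x y :=
  (continuousOn_div_genFun.mono (ordConnected_Ioc.uIcc_subset hx hy)).intervalIntegrable

/-- The integrand is at least 1 on (0,1]. This gives uniqueness of α and also its 1-Lipschitz
dependence on `u`, used for the limit in time. -/
theorem sub_le_integral_sub (ha : ∀ k < 2, a k = 0) {x y : ℝ} (hx : x ∈ Ioc (0 : ℝ) 1)
    (hy : y ∈ Ioc (0 : ℝ) 1) (hxy : x ≤ y) :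
    y - x ≤ (∫ x in x..1, x / genFun a x) - ∫ x in y..1, x / genFun a x := by
  have h1 : (1 : ℝ) ∈ Ioc (0 : ℝ) 1 := by simp
  rw [← intervalIntegral.integral_add_adjacent_intervals
    (intervalIntegrable_div_genFun hx hy) (intervalIntegrable_div_genFun hy h1),
    add_sub_cancel_right]
  have : ∫ _ in x..y, (1 : ℝ) = y - x := by simp
  rw [← this]
  refine intervalIntegral.integral_mono_on hxy (by simp) (intervalIntegrable_div_genFun hx hy)
    fun z hz => ?_
  have hz' : z ∈ Ioc (0 : ℝ) 1 := ⟨hx.1.trans_le hz.1, hz.2.trans hy.2⟩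
  exact (one_le_inv₀ hz'.1).2 hz'.2 |>.trans (inv_le_div_genFun ha hz')

theorem abs_sub_le_integral_sub (ha : ∀ k < 2, a k = 0) {x y : ℝ} (hx : x ∈ Ioc (0 : ℝ) 1)
    (hy : y ∈ Ioc (0 : ℝ) 1) :
    |x - y| ≤ |(∫ x in x..1, x / genFun a x) - ∫ x in y..1, x / genFun a x| := by
  rcases le_total x y with h | h
  · rw [abs_sub_comm, abs_of_nonneg (sub_nonneg.2 h)]
    exact (sub_le_integral_sub ha hx hy h).trans (le_abs_self _)
  · rw [abs_sub_comm (∫ x in x..1, _), abs_of_nonneg (sub_nonneg.2 h)]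
    exact (sub_le_integral_sub ha hy hx h).trans (le_abs_self _)

theorem eq_of_integral_eq (ha : ∀ k < 2, a k = 0) {x y : ℝ} (hx : x ∈ Ioc (0 : ℝ) 1)
    (hy : y ∈ Ioc (0 : ℝ) 1)
    (h : ∫ x in x..1, x / genFun a x = ∫ x in y..1, x / genFun a x) : x = y := by
  have := abs_sub_le_integral_sub ha hx hy
  rw [h, sub_self, abs_zero] at this
  exact sub_eq_zero.1 (abs_nonpos_iff.1 this)

theorem existsUnique_integral_eq (ha : ∀ k < 2, a k = 0) {u : ℝ} (hu : 0 ≤ u) :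
    ∃! y : ℝ, y ∈ Ioc (0 : ℝ) 1 ∧ ∫ x in y..1, x / genFun a x = u := by
  refine existsUnique_of_exists_of_unique ?_ fun x y hx hy =>
    eq_of_integral_eq ha hx.1 hy.1 (hx.2.trans hy.2.symm)
  have h1 : (1 : ℝ) ∈ Ioc (0 : ℝ) 1 := by simp
  -- By comparison with 1/x, whose integral over [e^(-u), 1] is `u`, the integral from this point is
  -- already at least `u`.
  have he : Real.exp (-u) ∈ Ioc (0 : ℝ) 1 := ⟨Real.exp_pos _, Real.exp_le_one_iff.2 (by linarith)⟩
  have hsub : Icc (Real.exp (-u)) 1 ⊆ Ioc (0 : ℝ) 1 := fun x hx => ⟨he.1.trans_le hx.1, hx.2⟩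
  have hc : ContinuousOn (fun y => ∫ x in y..1, x / genFun a x) (Icc (Real.exp (-u)) 1) := by
    have := intervalIntegral.continuousOn_primitive_interval_left (μ := volume)
      (f := fun x => x / genFun a x) (a := Real.exp (-u)) (b := 1) (by
        rw [uIcc_of_le he.2]
        exact (continuousOn_div_genFun.mono hsub).integrableOn_Icc)
    rwa [uIcc_of_le he.2] at this
  have hge : u ≤ ∫ x in Real.exp (-u)..1, x / genFun a x := by
    have : ∫ x in Real.exp (-u)..1, x⁻¹ = u := by
      rw [integral_inv_of_pos he.1 one_pos]
      simp [Real.log_exp]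
    calc u = ∫ x in Real.exp (-u)..1, x⁻¹ := this.symm
      _ ≤ _ := by
        refine intervalIntegral.integral_mono_on he.2 ?_ (intervalIntegrable_div_genFun he h1)
          fun z hz => inv_le_div_genFun ha (hsub hz)
        refine (ContinuousOn.inv₀ continuousOn_id fun z hz => ?_).intervalIntegrable
        rw [uIcc_of_le he.2] at hz
        exact (hsub hz).1.ne'
  obtain ⟨y, hy, hyu⟩ := intermediate_value_Icc' he.2 hc ⟨by simpa using hu, hge⟩
  exact ⟨y, hsub hy, hyu⟩

/-! ### Almost every vertex is decided -/

/-- The odd event lies inside the even one and has the same probability, so the difference is null.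
The bound on the arrival time is removed by letting it run through the naturals. -/
theorem ae_decided_root (a : PMF ℕ) (f : ℕ → ℕ) :
    ∀ᵐ ω ∂(jointLaw a), (∀ n, ω ∈ winSet f (2 * n)) → ∃ n, ω ∈ winSet f (2 * n + 1) := by
  have h (m : ℕ) : ∀ᵐ ω ∂(jointLaw a), (ω []).2 < (m : ℝ) → (∀ n, ω ∈ winSet f (2 * n)) →
      ∃ n, ω ∈ winSet f (2 * n + 1) := by
    have hl : MeasurableSet ({ω : Label → ℕ × ℝ | (ω []).2 < m} ∩ ⋃ n, winSet f (2 * n + 1)) :=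
      (measurableSet_lt (by fun_prop) measurable_const).inter
        (.iUnion fun n => measurableSet_winSet f _)
    have hsub : ({ω : Label → ℕ × ℝ | (ω []).2 < m} ∩ ⋃ n, winSet f (2 * n + 1)) ⊆
        {ω : Label → ℕ × ℝ | (ω []).2 < m} ∩ ⋂ n, winSet f (2 * n) :=
      inter_subset_inter_right _ (iUnion_subset fun n => subset_iInter fun m ω hω =>
        Wins.even_of_odd hω)
    have h0 := measureReal_sdiff (μ := jointLaw a) hsub hl
    rw [← upperProb, ← lowerProb, lowerProb_eq_upperProb a f m.cast_nonneg, sub_self,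
      measureReal_eq_zero_iff] at h0
    filter_upwards [measure_eq_zero_iff_ae_notMem.1 h0] with ω hω h1 h2
    by_contra h3
    exact hω ⟨⟨h1, mem_iInter.2 h2⟩, fun h4 => h3 (mem_iUnion.1 h4.2)⟩
  filter_upwards [ae_all_iff.2 h] with ω hω
  obtain ⟨m, hm⟩ := exists_nat_gt (ω []).2
  exact hω m hm

theorem measurePreserving_append (a : PMF ℕ) (v : Label) :
    MeasurePreserving (fun (ω : Label → ℕ × ℝ) w => ω (w ++ v)) (jointLaw a) (jointLaw a) :=
  ⟨by fun_prop, Measure.map_infinitePi_infinitePi_of_inj (List.append_left_injective v)⟩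

/-- Labels are countable, and the branch at any label other than `[]` has the same law as the whole
family, with `Nat.pred` children at its root. -/
theorem ae_decided (a : PMF ℕ) :
    ∀ᵐ ω ∂(jointLaw a), ∀ v, Decided (childNum id ω) (fun v => (ω v).2) v := by
  refine ae_all_iff.2 fun v => ?_
  cases v with
  | nil => exact ae_decided_root a id
  | cons i v =>
    filter_upwards [(measurePreserving_append a (i :: v)).quasiMeasurePreserving.ae
      (ae_decided_root a Nat.pred)] with ω hω
    simpa only [Decided, EventuallyWins, wins_append_iff] using hω

theorem measurable_zip :
    Measurable fun (p : (Label → ℕ) × (Label → ℝ)) v => (p.1 v, p.2 v) := by fun_prop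

theorem ae_ae_decided (a : PMF ℕ) :
    ∀ᵐ D ∂(treeLaw a), ∀ᵐ T ∂(arrivalLaw Label), ∀ v, Decided (numChildren D) T v := by
  have h := ae_decided a
  rw [← map_zip_eq_jointLaw] at h
  have := Measure.ae_ae_of_ae_prod (ae_of_ae_map measurable_zip.aemeasurable h)
  simpa only [childNum_id] using this

/-! ### From arrival times at labels to arrival times at vertices -/

open Classical in
/-- Extend arrival times at the vertices of the tree to all labels. -/
def extend (D : Label → ℕ) (T : Vertex D → ℝ) (v : Label) : ℝ :=
  if h : IsVertex D v then T ⟨v, h⟩ else 0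

theorem extend_val {D : Label → ℕ} (T : Vertex D → ℝ) (v : Vertex D) :
    extend D T v.1 = T v := by simp [extend, v.2]

theorem measurable_extend (D : Label → ℕ) : Measurable (extend D) := by
  refine measurable_pi_lambda _ fun v => ?_
  by_cases h : IsVertex D v
  · simp only [extend, h, dif_pos]
    fun_prop
  · simp only [extend, h, dif_neg, not_false_eq_true]
    fun_prop

theorem measurable_restrict_vertex (D : Label → ℕ) :
    Measurable fun (T : Label → ℝ) (v : Vertex D) => T v.1 :=
  measurable_pi_lambda _ fun v => measurable_pi_apply v.1

theorem map_restrict_arrivalLaw (D : Label → ℕ) :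
    (arrivalLaw Label).map (fun T (v : Vertex D) => T v.1) = arrivalLaw (Vertex D) :=
  Measure.map_infinitePi_infinitePi_of_inj Subtype.val_injective

/-- The truncations started at a vertex never look at absent labels, so the filler value 0 of
`extend` plays no role. -/
theorem wins_extend_restrict {D : Label → ℕ} {T : Label → ℝ} {v : Label} (hv : IsVertex D v)
    (n : ℕ) : Wins (numChildren D) (extend D fun v => T v.1) n v ↔ Wins (numChildren D) T n v :=
  Wins.congr (fun v hv => extend_val (fun v : Vertex D => T v.1) ⟨v, hv⟩) n v hv

theorem measurableSet_wins_prod (n : ℕ) (v : Label) :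
    MeasurableSet {p : (Label → ℕ) × (Label → ℝ) | Wins (numChildren p.1) p.2 n v} := by
  have := measurable_zip (measurableSet_wins id n v)
  simp only [childNum_id] at this
  exact this

theorem measurableSet_wins_right (D : Label → ℕ) (n : ℕ) (v : Label) :
    MeasurableSet {T : Label → ℝ | Wins (numChildren D) T n v} :=
  measurable_prodMk_left (measurableSet_wins_prod n v)

theorem measurableSet_decided (D : Label → ℕ) (v : Label) :
    MeasurableSet {T : Label → ℝ | Decided (numChildren D) T v} := by
  have h : MeasurableSet {T : Label → ℝ | EventuallyWins (numChildren D) T v} := by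
    simp only [EventuallyWins, ofPred_forall]
    exact .iInter fun n => measurableSet_wins_right D _ v
  refine h.imp ?_
  simp only [ofPred_exists]
  exact .iUnion fun n => measurableSet_wins_right D _ v

theorem ae_decided_extend {D : Label → ℕ}
    (h : ∀ᵐ T ∂(arrivalLaw Label), ∀ v, Decided (numChildren D) T v) :
    ∀ᵐ T ∂(arrivalLaw (Vertex D)), ∀ v, IsVertex D v →
      Decided (numChildren D) (extend D T) v := by
  rw [← map_restrict_arrivalLaw, ae_map_iff (measurable_restrict_vertex D).aemeasurable]
  · filter_upwards [h] with T hT v hv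
    simpa only [Decided, EventuallyWins, wins_extend_restrict hv] using hT v
  · simp only [ofPred_forall]
    exact .iInter fun v => .iInter fun _ => measurable_extend D (measurableSet_decided D v)

theorem existsUnique_isAccepted_extend {D : Label → ℕ} {T : Vertex D → ℝ}
    (h : ∀ v, IsVertex D v → Decided (numChildren D) (extend D T) v) :
    (∃! P, IsAccepted (tree D) T P) ∧
      IsAccepted (tree D) T fun k => Accepted (numChildren D) (extend D T) k.1 := by
  have hT : (fun k : Vertex D => extend D T k.1) = T := funext fun k => extend_val T k
  have h1 := existsUnique_isAccepted h
  have h2 := isAccepted_accepted h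
  rw [hT] at h1 h2
  exact ⟨h1, h2⟩

/-- The event that the root is occupied at time `t`. -/
def occupiedSet (t : ℝ) : Set ((Label → ℕ) × (Label → ℝ)) :=
  {p | p.2 [] ≤ t ∧ EventuallyWins (numChildren p.1) p.2 []}

theorem measurableSet_occupiedSet (t : ℝ) : MeasurableSet (occupiedSet t) := by
  have h : MeasurableSet {p : (Label → ℕ) × (Label → ℝ) |
      EventuallyWins (numChildren p.1) p.2 []} := by
    simp only [EventuallyWins, ofPred_forall]
    exact .iInter fun n => measurableSet_wins_prod _ _
  exact (measurableSet_le ((measurable_pi_apply []).comp measurable_snd) measurable_const).inter h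

theorem ae_occupation_eq {D : Label → ℕ}
    (h : ∀ᵐ T ∂(arrivalLaw Label), ∀ v, Decided (numChildren D) T v) (t : ℝ) :
    occupation (tree D) (root D) t =ᵐ[arrivalLaw (Vertex D)]
      fun T => (Prod.mk D ⁻¹' occupiedSet t).indicator 1 (extend D T) := by
  filter_upwards [ae_decided_extend h] with T hT
  obtain ⟨h1, h2⟩ := existsUnique_isAccepted_extend hT
  have key := parking_eq_one_iff h2 h1 t (root D)
  have hr : T (root D) = extend D T [] := (extend_val T (root D)).symm
  rw [hr] at key
  by_cases ho : (D, extend D T) ∈ occupiedSet t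
  · rw [indicator_of_mem (mem_preimage.2 ho), occupation, key.2 ho]
    simp
  · have : parking (tree D) T t (root D) = 0 := by
      have := mt key.1 ho
      omega
    rw [indicator_of_notMem (fun h => ho (mem_preimage.1 h)), occupation, this]
    simp

theorem measurable_slice (D : Label → ℕ) (t : ℝ) :
    MeasurableSet (Prod.mk D ⁻¹' occupiedSet t) :=
  measurable_prodMk_left (measurableSet_occupiedSet t)

theorem integrable_occupation {D : Label → ℕ}
    (h : ∀ᵐ T ∂(arrivalLaw Label), ∀ v, Decided (numChildren D) T v) (t : ℝ) :
    Integrable (occupation (tree D) (root D) t) (arrivalLaw (Vertex D)) := by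
  refine Integrable.congr ?_ (ae_occupation_eq h t).symm
  exact ((integrable_const (1 : ℝ)).indicator (measurable_extend D (measurable_slice D t)))

/-- The space of arrival times at vertices varies with `D`; moving to all labels gives one fixed
space, on which Fubini applies. -/
theorem meanOccupation_eq {D : Label → ℕ}
    (h : ∀ᵐ T ∂(arrivalLaw Label), ∀ v, Decided (numChildren D) T v) (t : ℝ) :
    meanOccupation (tree D) (root D) t =
      (arrivalLaw Label).real (Prod.mk D ⁻¹' occupiedSet t) := by
  have hm : Measurable fun T =>
      (Prod.mk D ⁻¹' occupiedSet t).indicator (1 : (Label → ℝ) → ℝ) (extend D T) :=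
    (measurable_one.indicator (measurable_slice D t)).comp (measurable_extend D)
  rw [meanOccupation, integral_congr_ae (ae_occupation_eq h t), ← map_restrict_arrivalLaw,
    integral_map (measurable_restrict_vertex D).aemeasurable hm.aestronglyMeasurable,
    ← integral_indicator_one (measurable_slice D t)]
  refine integral_congr_ae (ae_of_all _ fun T => ?_)
  have : extend D (fun v => T v.1) ∈ Prod.mk D ⁻¹' occupiedSet t ↔
      T ∈ Prod.mk D ⁻¹' occupiedSet t := by
    simp only [occupiedSet, mem_preimage, mem_ofPred_eq, EventuallyWins,
      wins_extend_restrict (D := D) (v := []) trivial]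
    rw [show extend D (fun v => T v.1) [] = T [] from extend_val _ (root D)]
  by_cases hT : T ∈ Prod.mk D ⁻¹' occupiedSet t
  · exact (indicator_of_mem (this.2 hT) 1).trans (indicator_of_mem hT 1).symm
  · exact (indicator_of_notMem (mt this.1 hT) _).trans (indicator_of_notMem hT _).symm

theorem ae_meanOccupation_eq (a : PMF ℕ) (t : ℝ) :
    (fun D => meanOccupation (tree D) (root D) t) =ᵐ[treeLaw a]
      fun D => (arrivalLaw Label).real (Prod.mk D ⁻¹' occupiedSet t) := by
  filter_upwards [ae_ae_decided a] with D hD using meanOccupation_eq hD t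

theorem integrable_meanOccupation (a : PMF ℕ) (t : ℝ) :
    Integrable (fun D => meanOccupation (tree D) (root D) t) (treeLaw a) := by
  refine Integrable.congr ?_ (ae_meanOccupation_eq a t).symm
  refine Integrable.of_bound (measurable_measure_prodMk_left
    (measurableSet_occupiedSet t)).ennreal_toReal.aestronglyMeasurable 1 (ae_of_all _ fun D => ?_)
  rw [Real.norm_of_nonneg measureReal_nonneg]
  exact measureReal_le_one

theorem measure_arrival_eq (a : PMF ℕ) (t : ℝ) : jointLaw a {ω | (ω []).2 = t} = 0 := by
  have h : MeasurePreserving (fun ω : Label → ℕ × ℝ => (ω []).2) (jointLaw a) (expMeasure 1) :=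
    measurePreserving_snd.comp (measurePreserving_eval_infinitePi (fun _ => siteLaw a) [])
  change jointLaw a ((fun ω => (ω []).2) ⁻¹' {t}) = 0
  rw [h.measure_preimage (measurableSet_singleton t).nullMeasurableSet]
  exact withDensity_absolutelyContinuous _ _ (measure_singleton t)

theorem averagedOccupation_eq (a : PMF ℕ) (t : ℝ) :
    averagedOccupation a t = upperProb a id t := by
  rw [averagedOccupation, integral_congr_ae (ae_meanOccupation_eq a t)]
  simp only [measureReal_def]
  rw [integral_toReal (measurable_measure_prodMk_left (measurableSet_occupiedSet t)).aemeasurable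
    (ae_of_all _ fun D => measure_lt_top _ _), ← Measure.prod_apply (measurableSet_occupiedSet t),
    upperProb, measureReal_def]
  have hpre : occupiedSet t = (fun (p : (Label → ℕ) × (Label → ℝ)) v => (p.1 v, p.2 v)) ⁻¹'
      ({ω | (ω []).2 ≤ t} ∩ ⋂ n, winSet id (2 * n)) := by
    ext p
    simp [occupiedSet, winSet, EventuallyWins, childNum_id]
  have hw : MeasurableSet (⋂ n, winSet id (2 * n)) := .iInter fun n => measurableSet_winSet _ _
  rw [hpre, ← Measure.map_apply measurable_zip
    ((measurableSet_le (by fun_prop) measurable_const).inter hw), map_zip_eq_jointLaw]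
  congr 1
  refine measure_congr ?_
  -- Occupation uses arrivals up to and including `t`, `upperProb` those strictly before; arrival
  -- times have no atoms.
  filter_upwards [measure_eq_zero_iff_ae_notMem.1 (measure_arrival_eq a t)] with ω hω
  have : (ω []).2 ≤ t ↔ (ω []).2 < t := le_iff_lt_or_eq.trans (or_iff_left hω)
  exact propext (and_congr_left' this)

/-! ### The occupation formula and its limit in time -/

theorem averagedOccupation_formula (ha : ∀ k < 2, a k = 0) {t y : ℝ} (ht : 0 ≤ t)
    (hy : y ∈ Ioc (0 : ℝ) 1) (h : ∫ x in y..1, x / genFun a x = 1 - Real.exp (-t)) :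
    averagedOccupation a t = (1 - y ^ 2) / 2 := by
  rw [averagedOccupation_eq, upperProb_id_eq ha ht, eq_of_integral_eq ha (x := y) hy
    ⟨sub_pos.2 (upperProb_lt_one a _ ht), sub_le_self _ (upperProb_mem a _ t).1⟩
    (h.trans (integral_div_genFun ha ht).symm)]

theorem exists_averagedOccupation_formula (ha : ∀ k < 2, a k = 0) {t : ℝ} (ht : 0 ≤ t) :
    ∃ y ∈ Ioc (0 : ℝ) 1, ∫ x in y..1, x / genFun a x = 1 - Real.exp (-t) ∧
      averagedOccupation a t = (1 - y ^ 2) / 2 := by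
  obtain ⟨y, ⟨hy, h⟩, -⟩ := existsUnique_integral_eq ha (u := 1 - Real.exp (-t))
    (sub_nonneg.2 (Real.exp_le_one_iff.2 (by linarith)))
  exact ⟨y, hy, h, averagedOccupation_formula ha ht hy h⟩

theorem tendsto_averagedOccupation (ha : ∀ k < 2, a k = 0) {y : ℝ} (hy : y ∈ Ioc (0 : ℝ) 1)
    (h : ∫ x in y..1, x / genFun a x = 1) :
    Tendsto (averagedOccupation a) atTop (𝓝 ((1 - y ^ 2) / 2)) := by
  -- The arguments 1 - e^(-t) and 1 differ by e^(-t), and α is 1-Lipschitz.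
  have hex : ∀ t : ℝ, ∃ z, 0 ≤ t → |z - y| ≤ Real.exp (-t) ∧
      averagedOccupation a t = (1 - z ^ 2) / 2 := fun t => by
    by_cases ht : 0 ≤ t
    · obtain ⟨z, hz, h1, h2⟩ := exists_averagedOccupation_formula ha ht
      refine ⟨z, fun _ => ⟨(abs_sub_le_integral_sub ha hz hy).trans_eq ?_, h2⟩⟩
      rw [h1, h, sub_sub_cancel_left, abs_neg, abs_of_pos (Real.exp_pos _)]
    · exact ⟨0, fun h => absurd h ht⟩
  choose z hz using hex
  have hlim : Tendsto z atTop (𝓝 y) := by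
    rw [tendsto_iff_dist_tendsto_zero]
    refine squeeze_zero' (Eventually.of_forall fun _ => dist_nonneg) ?_
      (Real.tendsto_exp_atBot.comp tendsto_neg_atTop_atBot)
    filter_upwards [eventually_ge_atTop 0] with t ht using (hz t ht).1
  refine (((hlim.pow 2).const_sub 1).div_const 2).congr' ?_
  filter_upwards [eventually_ge_atTop 0] with t ht using (hz t ht).2.symm

/-! ### Regular trees -/

theorem treeLaw_pure (d : ℕ) : treeLaw (PMF.pure d) = Measure.dirac fun _ => d := by
  simp only [treeLaw, PMF.toMeasure_pure]
  exact Measure.infinitePi_dirac _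

theorem averagedOccupation_pure (d : ℕ) (t : ℝ) :
    averagedOccupation (PMF.pure d) t =
      meanOccupation (tree fun _ => d) (root fun _ => d) t := by
  rw [averagedOccupation, treeLaw_pure, integral_dirac]

theorem genFun_pure (d : ℕ) (x : ℝ) : genFun (PMF.pure d) x = x ^ d := by
  rw [genFun, tsum_eq_single d fun k hk => by simp [PMF.pure_apply, hk]]
  simp

theorem pure_apply_of_lt {d : ℕ} (hd : 2 ≤ d) : ∀ k < 2, PMF.pure d k = 0 := fun k hk => by
  rw [PMF.pure_apply, if_neg (by omega)]

theorem meanOccupation_integers {t : ℝ} (ht : 0 ≤ t) :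
    meanOccupation (tree fun _ => 2) (root fun _ => 2) t
      = (1 - Real.exp (-2 * (1 - Real.exp (-t)))) / 2 := by
  obtain ⟨y, hy, h1, h2⟩ := exists_averagedOccupation_formula (pure_apply_of_lt le_rfl) ht
  have hint : ∫ x in y..1, x / genFun (PMF.pure 2) x = ∫ x in y..1, x⁻¹ := by
    refine intervalIntegral.integral_congr fun x _ => ?_
    simp only [genFun_pure]
    rcases eq_or_ne x 0 with rfl | hx
    -- Both sides are 0 here, by the convention for division by zero.
    · simp
    · field_simp
  rw [hint, integral_inv_of_pos hy.1 one_pos, one_div, Real.log_inv] at h1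
  rw [← averagedOccupation_pure, h2, ← h1]
  congr 2
  rw [neg_mul_neg, mul_comm, Real.exp_mul, Real.exp_log hy.1]
  norm_num

theorem meanOccupation_regular {d : ℕ} (hd : 2 < d) {t : ℝ} (ht : 0 ≤ t) :
    meanOccupation (tree fun _ => d) (root fun _ => d) t
      = (1 - (1 + ((d : ℝ) - 2) * (1 - Real.exp (-t))) ^ (-(2 / ((d : ℝ) - 2)))) / 2 := by
  obtain ⟨y, hy, h1, h2⟩ := exists_averagedOccupation_formula (pure_apply_of_lt hd.le) ht
  have hd' : (2 : ℝ) < d := by exact_mod_cast hd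
  have hd2 : (d : ℝ) - 2 ≠ 0 := by linarith
  have hd3 : (2 : ℝ) - d ≠ 0 := by linarith
  have hpos : ∀ x ∈ uIcc y 1, 0 < x := fun x hx => by
    rw [uIcc_of_le hy.2] at hx
    exact hy.1.trans_le hx.1
  have hint : ∫ x in y..1, x / genFun (PMF.pure d) x = ∫ x in y..1, x ^ (1 - d : ℝ) := by
    refine intervalIntegral.integral_congr fun x hx => ?_
    simp only [genFun_pure]
    rw [Real.rpow_sub (hpos x hx), Real.rpow_one, Real.rpow_natCast]
  rw [hint, integral_rpow (Or.inr ⟨by linarith, fun h => lt_irrefl _ (hpos 0 h)⟩),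
    Real.one_rpow, show (1 - d : ℝ) + 1 = 2 - d by ring, div_eq_iff hd3] at h1
  -- The integral of x^(1-d) over [y, 1] is (1 - y^(2-d))/(2-d); the power -2/(d-2) then turns
  -- y^(2-d) into y².
  have hy2 : 1 + ((d : ℝ) - 2) * (1 - Real.exp (-t)) = y ^ (2 - d : ℝ) := by linarith
  rw [← averagedOccupation_pure, h2, hy2, ← Real.rpow_mul hy.1.le,
    show (2 - d : ℝ) * -(2 / (d - 2)) = (2 : ℕ) by push_cast; field_simp; ring,
    Real.rpow_natCast]

end RandomTreeParking

end

theorem mainTheorem1 (a : PMF ℕ) (ha : ∀ k < 2, a k = 0) :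
    -- the parking process is well defined on almost every tree
    (∀ᵐ D ∂(RandomTreeParking.treeLaw a),
      ∀ᵐ T ∂(RandomTreeParking.arrivalLaw (RandomTreeParking.Vertex D)),
        ∃! n, RandomTreeParking.IsParkingHistory (RandomTreeParking.tree D) T n) ∧
    -- the averages over the dynamics and over the trees exist
    (∀ t : ℝ, 0 ≤ t →
      (∀ᵐ D ∂(RandomTreeParking.treeLaw a),
        Integrable
          (RandomTreeParking.occupation (RandomTreeParking.tree D) (RandomTreeParking.root D) t)
          (RandomTreeParking.arrivalLaw (RandomTreeParking.Vertex D))) ∧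
      Integrable
        (fun D => RandomTreeParking.meanOccupation
          (RandomTreeParking.tree D) (RandomTreeParking.root D) t)
        (RandomTreeParking.treeLaw a)) ∧
    -- the equation for `α(u)` has exactly one solution
    (∀ u : ℝ, 0 ≤ u →
      ∃! y : ℝ, y ∈ Ioc (0 : ℝ) 1 ∧ ∫ x in y..1, x / RandomTreeParking.genFun a x = u) ∧
    -- the occupation probability at time `t`, and the parking constant
    (∀ α : ℝ → ℝ,
      (∀ u ∈ Icc (0 : ℝ) 1, α u ∈ Ioc (0 : ℝ) 1 ∧
        ∫ x in (α u)..1, x / RandomTreeParking.genFun a x = u) →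
      (∀ t : ℝ, 0 ≤ t →
        RandomTreeParking.averagedOccupation a t = (1 - α (1 - Real.exp (-t)) ^ 2) / 2) ∧
      Tendsto (RandomTreeParking.averagedOccupation a) atTop (𝓝 ((1 - α 1 ^ 2) / 2))) ∧
    -- the deterministic case: the integers (`d = 2`) and the other regular trees
    (∀ t : ℝ, 0 ≤ t →
      RandomTreeParking.meanOccupation
          (RandomTreeParking.tree fun _ => 2) (RandomTreeParking.root fun _ => 2) t
        = (1 - Real.exp (-2 * (1 - Real.exp (-t)))) / 2) ∧
    (∀ d : ℕ, 2 < d → ∀ t : ℝ, 0 ≤ t →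
      RandomTreeParking.meanOccupation
          (RandomTreeParking.tree fun _ => d) (RandomTreeParking.root fun _ => d) t
        = (1 - (1 + ((d : ℝ) - 2) * (1 - Real.exp (-t))) ^ (-(2 / ((d : ℝ) - 2)))) / 2) := by
  open RandomTreeParking in
  refine ⟨?_, fun t _ => ⟨?_, integrable_meanOccupation a t⟩,
    fun u hu => existsUnique_integral_eq ha hu, fun α hα => ⟨fun t ht => ?_, ?_⟩,
    fun t ht => meanOccupation_integers ht, fun d hd t ht => meanOccupation_regular hd ht⟩
  · filter_upwards [ae_ae_decided a] with D hD
    filter_upwards [ae_decided_extend hD] with T hT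
    exact existsUnique_isParkingHistory (existsUnique_isAccepted_extend hT).1
  · filter_upwards [ae_ae_decided a] with D hD using integrable_occupation hD t
  · obtain ⟨h1, h2⟩ := hα (1 - Real.exp (-t))
      ⟨sub_nonneg.2 (Real.exp_le_one_iff.2 (by linarith)), sub_le_self _ (Real.exp_pos _).le⟩
    exact averagedOccupation_formula ha ht h1 h2
  · obtain ⟨h1, h2⟩ := hα 1 (by simp)
    exact tendsto_averagedOccupation ha h1 h2
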